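/- Let $d\ge 2$, let $\Sigma\subset\mathbb{R}^d$ be a compact set that contains a nonempty open subset of $\mathbb{R}^d$, let $\mathbb{F}=\mathbb{R}$ or $\mathbb{C}$, and let $n,m$ be positive integers. A function $\Sigma\to\mathbb{R}$ is called real-analytic if it extends to a real-analytic function on an open neighborhood of $\Sigma$; a matrix-valued function on $\Sigma$ is real-analytic if the real and imaginary parts of all its entries are. For $2\le p<\infty$ let $X^p=L^p(\Sigma,\mathbb{F}^n)$ (Lebesgue measure), and let $X^\infty=C^0(\Sigma,\mathbb{F}^n)$ be the space of continuous functions. For $A:\Sigma\to\mathbb{F}^{n\times n}$ and $B:\Sigma\to\mathbb{F}^{n\times m}$ consider the linear ensemble system $$\dot x(t,\sigma)=A(\sigma)x(t,\sigma)+B(\sigma)u(t),\qquad \sigma\in\Sigma,$$ with a common input $u$. The pair $(A,B)$ is called $L^p$-controllable if for every initial profile $x_0\in X^p$, every target profile $\hat x\in X^p$ and every $\epsilon>0$ there are a time $T>0$ and an integrable input $u:[0,T]\to\mathbb{F}^m$ such that the solution with $x(0,\cdot)=x_0$ satisfies $\|x(T,\cdot)-\hat x\|_{L^p}<\epsilon$.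 Then, for every $p\in[2,\infty]$, there is no pair of real-analytic functions $A:\Sigma\to\mathbb{F}^{n\times n}$, $B:\Sigma\to\mathbb{F}^{n\times m}$ such that $(A,B)$ is $L^p$-controllable. Moreover, for every real-analytic pair $(A,B)$ and every $p\in[2,\infty]$, the closure in $X^p$, with respect to $\|\cdot\|_{L^p}$, of the $\mathbb{F}$-linear span of the columns of the functions $A^kB$, $k\ge 0$, is not all of $X^p$. (For $p=\infty$, $\|\cdot\|_{L^\infty}$ is the essential supremum; both assertions therefore hold a fortiori with the supremum norm on $C^0(\Sigma,\mathbb{F}^n)$.) -/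

import Mathlib

open MeasureTheory
open scoped ENNReal

namespace LinearEnsemble

/-- A real function on a subset `S` of `ℝ^d` is real-analytic if it extends to a real-analytic
function on an open neighborhood of `S`. -/
def IsRealAnalytic {d : ℕ} {S : Set (EuclideanSpace ℝ (Fin d))} (f : S → ℝ) : Prop :=
  ∃ U : Set (EuclideanSpace ℝ (Fin d)), IsOpen U ∧ S ⊆ U ∧
    ∃ g : EuclideanSpace ℝ (Fin d) → ℝ, AnalyticOnNhd ℝ g U ∧ ∀ σ : S, g σ = f σ

/-- A matrix-valued function on `S` is real-analytic if the real and imaginary parts of all its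
entries are. -/
def IsRealAnalyticMatrix {𝕜 : Type*} [RCLike 𝕜] {d : ℕ} {S : Set (EuclideanSpace ℝ (Fin d))}
    {k l : ℕ} (F : S → Matrix (Fin k) (Fin l) 𝕜) : Prop :=
  ∀ i j, IsRealAnalytic (fun σ => RCLike.re (F σ i j)) ∧
    IsRealAnalytic (fun σ => RCLike.im (F σ i j))

/-- Lebesgue measure on a (measurable) subset `S` of `ℝ^d`. -/
noncomputable def lebesgueOn {d : ℕ} (S : Set (EuclideanSpace ℝ (Fin d))) : Measure S :=
  Measure.comap Subtype.val volume

/-- The space `X^p` of profiles `S → 𝕜^n`: the `L^p` functions with respect to Lebesgue measure on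
`S` if `p < ∞`, and the continuous functions if `p = ∞`. -/
def profileSpace (𝕜 : Type*) [RCLike 𝕜] {d : ℕ} (S : Set (EuclideanSpace ℝ (Fin d))) (n : ℕ)
    (p : ℝ≥0∞) : Set (S → EuclideanSpace 𝕜 (Fin n)) :=
  {f | (p ≠ ∞ → MemLp f p (lebesgueOn S)) ∧ (p = ∞ → Continuous f)}

/-- `x` solves `∂x/∂t (t, σ) = A(σ) x(t, σ) + B(σ) u(t)` on `[0, T]`, for every `σ ∈ S`, with
initial profile `x₀`, in the sense of Carathéodory (the input `u` is only integrable). -/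
def IsSolution {𝕜 : Type*} [RCLike 𝕜] {d : ℕ} {S : Set (EuclideanSpace ℝ (Fin d))} {n m : ℕ}
    (A : S → Matrix (Fin n) (Fin n) 𝕜) (B : S → Matrix (Fin n) (Fin m) 𝕜)
    (T : ℝ) (u : ℝ → EuclideanSpace 𝕜 (Fin m)) (x₀ : S → EuclideanSpace 𝕜 (Fin n))
    (x : ℝ → S → EuclideanSpace 𝕜 (Fin n)) : Prop :=
  ∀ σ : S, ContinuousOn (fun t => x t σ) (Set.Icc 0 T) ∧
    ∀ t ∈ Set.Icc (0 : ℝ) T, x t σ = x₀ σ +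
      ∫ s in (0 : ℝ)..t, (Matrix.toEuclideanLin (A σ) (x s σ) + Matrix.toEuclideanLin (B σ) (u s))

/-- `L^p`-controllability of the pair `(A, B)`. -/
def LpControllable {𝕜 : Type*} [RCLike 𝕜] {d : ℕ} {S : Set (EuclideanSpace ℝ (Fin d))} {n m : ℕ}
    (p : ℝ≥0∞) (A : S → Matrix (Fin n) (Fin n) 𝕜) (B : S → Matrix (Fin n) (Fin m) 𝕜) : Prop :=
  ∀ x₀ ∈ profileSpace 𝕜 S n p, ∀ xhat ∈ profileSpace 𝕜 S n p, ∀ ε : ℝ, 0 < ε →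
    ∃ T : ℝ, 0 < T ∧ ∃ u : ℝ → EuclideanSpace 𝕜 (Fin m), IntegrableOn u (Set.Icc 0 T) ∧
      ∃ x : ℝ → S → EuclideanSpace 𝕜 (Fin n), IsSolution A B T u x₀ x ∧
        eLpNorm (fun σ => x T σ - xhat σ) p (lebesgueOn S) < ENNReal.ofReal ε

/-- The `j`-th column of `A^k B`, as a profile. -/
def column {𝕜 : Type*} [RCLike 𝕜] {d : ℕ} {S : Set (EuclideanSpace ℝ (Fin d))} {n m : ℕ}
    (A : S → Matrix (Fin n) (Fin n) 𝕜) (B : S → Matrix (Fin n) (Fin m) 𝕜) (k : ℕ) (j : Fin m) :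
    S → EuclideanSpace 𝕜 (Fin n) :=
  fun σ => WithLp.toLp 2 (fun i => (A σ ^ k * B σ) i j)

/-- The `L^p`-controllable subspace of `(A, B)`: the `L^p`-closure in `X^p` of the span over `𝕜` of
the columns of `A^k B`, `k ≥ 0`. -/
def controllableSubspace {𝕜 : Type*} [RCLike 𝕜] {d : ℕ} {S : Set (EuclideanSpace ℝ (Fin d))}
    {n m : ℕ} (p : ℝ≥0∞) (A : S → Matrix (Fin n) (Fin n) 𝕜)
    (B : S → Matrix (Fin n) (Fin m) 𝕜) : Set (S → EuclideanSpace 𝕜 (Fin n)) :=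
  {f | f ∈ profileSpace 𝕜 S n p ∧ ∀ ε : ℝ, 0 < ε →
    ∃ g ∈ Submodule.span 𝕜 (Set.range fun kj : ℕ × Fin m => column A B kj.1 kj.2),
      eLpNorm (fun σ => f σ - g σ) p (lebesgueOn S) < ENNReal.ofReal ε}

end LinearEnsemble

/-!
The columns of the functions `A ^ k * B`, `k ≥ 0`, satisfy a common linear differential equation on
a ball contained in `S`, and this prevents their span from being dense.

Fix two coordinate directions with derivatives `∂₁`, `∂₂`, and a point `x`. The jet at `x` formed by
the derivatives `∂₁ ^ a ∂₂ ^ b`, `a, b ≤ N`, of a profile with `n` components has `n (N + 1) ^ 2`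
entries. By Cayley-Hamilton, the matrix `χ(A)`, with `χ` the characteristic polynomial of `A x`,
vanishes at `x`, so `χ(A) ^ (2 N + 1)` has vanishing jet. Hence the jet of a column of
`q(A) * B` depends only on the polynomial `q` modulo `χ ^ (2 N + 1)`, and the jets of all columns of
all `A ^ k * B` span a space of dimension at most `m n (2 N + 1)`
(`finrank_span_jets_le`). For `N = 2 m` this is less than `n (N + 1) ^ 2`; this is where two
dimensions are needed. Expanding a nonvanishing minor of maximal size along an additional column
gives smooth coefficients `c`, not all zero, with `∑ c_{a,b,l} ∂₁ ^ a ∂₂ ^ b (A ^ k * B)_{l j} = 0`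
for all `k` and `j` (`exists_relation_of_finrank_span_lt`, `exists_differential_relation`).

Multiplying this relation by a test function and integrating by parts yields a smooth compactly
supported `Φ ≠ 0` with `∫ Φ · (A ^ k * B)_j = 0` for all `k` and `j` (`exists_annihilator`). Pairing
with `Φ` is continuous for the `L^p` norm, so the closure of the span of the columns is proper
(`controllableSubspace_ne_profileSpace`).

Finally, a solution with zero initial profile is the sum of the series `∑ A ^ k B v_k(T)`, where
`v_k` is the `(k + 1)`-fold iterated primitive of the input, and this series converges uniformly on
`S`. Thus every reachable profile lies in the controllable subspace, and controllability would force
that subspace to be everything (`LpControllable.controllableSubspace_eq`).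
-/

namespace LinearEnsemble

/-! ### Jets of the columns of `A ^ k * B` and relations between them -/

/-- Each application of a derivation lowers the order of vanishing, measured by powers of an ideal,
by at most one. -/
theorem derivation_iterate_mem_pow {K R : Type*} [CommRing K] [CommRing R] [Algebra K R]
    (D : Derivation K R R) (I : Ideal R) (a M : ℕ) {x : R} (hx : x ∈ I ^ (M + a)) :
    (⇑D)^[a] x ∈ I ^ M := by
  have step : ∀ (M : ℕ) (x : R), x ∈ I ^ (M + 1) → D x ∈ I ^ M := by
    intro M
    induction M with
    | zero => intro x _; simp
    | succ M ih =>
      intro x hx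
      rw [pow_succ] at hx
      refine Submodule.mul_induction_on hx ?_ ?_
      · intro y hy z hz
        rw [Derivation.leibniz, smul_eq_mul, smul_eq_mul]
        refine Ideal.add_mem _ (Ideal.mul_mem_right _ _ hy) ?_
        rw [pow_succ, mul_comm z]
        exact Ideal.mul_mem_mul (ih y hy) hz
      · intro y z hy hz
        rw [map_add]
        exact Ideal.add_mem _ hy hz
  induction a generalizing x with
  | zero => simpa using hx
  | succ a ih =>
    rw [Function.iterate_succ_apply]
    exact ih (step _ _ hx)

theorem matrix_pow_entry_mem_pow {R : Type*} [CommRing R] {n : ℕ} (I : Ideal R)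
    (C : Matrix (Fin n) (Fin n) R) (hC : ∀ i j, C i j ∈ I) (M : ℕ) (i j : Fin n) :
    (C ^ M) i j ∈ I ^ M := by
  induction M generalizing i j with
  | zero => simp
  | succ M ih =>
    rw [pow_succ, pow_succ, Matrix.mul_apply]
    exact Ideal.sum_mem _ fun k _ => Ideal.mul_mem_mul (ih i k) (hC k j)

/-- If a linear map `L` (such as taking a jet at a point) kills all vectors that vanish to order `M`
at the point `ev`, then the values of `L` on the columns of `A ^ k * B` span a space whose dimension
is bounded independently of the number of powers: `A ^ k` may be replaced by the remainder of
`X ^ k` modulo the `M`-th power of the characteristic polynomial of `ev A`, evaluated at `A`. -/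
theorem finrank_span_jets_le {K R V : Type*} [Field K] [CommRing R] [Algebra K R]
    [AddCommGroup V] [Module K V] {n m : ℕ} (M : ℕ) (ev : R →ₐ[K] K)
    (L : (Fin n → R) →ₗ[K] V)
    (hL : ∀ v : Fin n → R, (∀ l, v l ∈ RingHom.ker ev ^ M) → L v = 0)
    (A : Matrix (Fin n) (Fin n) R) (B : Matrix (Fin n) (Fin m) R) :
    Module.finrank K (Submodule.span K
      (Set.range fun kj : ℕ × Fin m => L fun l => (A ^ kj.1 * B) l kj.2)) ≤ n * M * m := by
  classical
  let A₀ : Matrix (Fin n) (Fin n) K := ev.mapMatrix A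
  let χ := A₀.charpoly
  have hχ : (χ ^ M).Monic := (Matrix.charpoly_monic A₀).pow M
  have hdeg : (χ ^ M).natDegree = n * M := by
    rw [(Matrix.charpoly_monic A₀).natDegree_pow, Matrix.charpoly_natDegree_eq_dim]
    simp [mul_comm]
  have hentry : ∀ i j, (Polynomial.aeval A χ) i j ∈ RingHom.ker ev := by
    intro i j
    have h1 : ev.mapMatrix (Polynomial.aeval A χ) = 0 := by
      rw [← Polynomial.aeval_algHom_apply]
      exact Matrix.aeval_self_charpoly A₀
    have h2 := congrFun (congrFun h1 i) j
    simpa [RingHom.mem_ker] using h2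
  have hzero : ∀ (q : Polynomial K) (j : Fin m),
      L (fun l => (Polynomial.aeval A (χ ^ M * q) * B) l j) = 0 := by
    intro q j
    refine hL _ fun l => ?_
    rw [map_mul, map_pow, Matrix.mul_assoc, Matrix.mul_apply]
    exact Ideal.sum_mem _ fun k _ =>
      Ideal.mul_mem_right _ _ (matrix_pow_entry_mem_pow _ _ hentry M l k)
  -- Division of `X ^ k` by `χ ^ M` reduces the powers of `A` to those below `n * M`.
  have hle : Submodule.span K
        (Set.range fun kj : ℕ × Fin m => L fun l => (A ^ kj.1 * B) l kj.2) ≤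
      Submodule.span K (Set.range fun kj : Fin (n * M) × Fin m =>
        L fun l => (A ^ (kj.1 : ℕ) * B) l kj.2) := by
    rw [Submodule.span_le]
    rintro _ ⟨⟨k, j⟩, rfl⟩
    let q : Polynomial K := Polynomial.X ^ k %ₘ χ ^ M
    have hq : q.natDegree < n * M ∨ q = 0 := by
      by_cases h1 : χ ^ M = 1
      · right; simp [q, h1]
      · left
        rw [← hdeg]
        exact Polynomial.natDegree_modByMonic_lt _ hχ h1
    have hqsum : q = ∑ i ∈ Finset.range (n * M), Polynomial.C (q.coeff i) * Polynomial.X ^ i := by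
      rcases hq with h | h
      · exact q.as_sum_range_C_mul_X_pow' h
      · simp [h]
    have hA : L (fun l => (A ^ k * B) l j) =
        ∑ i ∈ Finset.range (n * M), q.coeff i • L (fun l => (A ^ i * B) l j) := by
      have h1 : A ^ k = Polynomial.aeval A q +
          Polynomial.aeval A (χ ^ M * (Polynomial.X ^ k /ₘ χ ^ M)) := by
        rw [← map_add, Polynomial.modByMonic_add_div]
        simp
      have h2 : Polynomial.aeval A q = ∑ i ∈ Finset.range (n * M), q.coeff i • A ^ i := by
        conv_lhs => rw [hqsum]
        simp [Algebra.smul_def]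
      have h3 : (fun l => (A ^ k * B) l j) =
          (∑ i ∈ Finset.range (n * M), q.coeff i • fun l => (A ^ i * B) l j) +
          fun l => (Polynomial.aeval A (χ ^ M * (Polynomial.X ^ k /ₘ χ ^ M)) * B) l j := by
        funext l
        conv_lhs => rw [h1, h2]
        simp [Matrix.add_mul, Matrix.sum_mul, Matrix.sum_apply]
      rw [h3, map_add, hzero, add_zero, map_sum]
      simp
    change L (fun l => (A ^ k * B) l j) ∈ _
    rw [hA]
    refine Submodule.sum_mem _ fun i hi => Submodule.smul_mem _ _ (Submodule.subset_span ?_)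
    exact ⟨(⟨i, Finset.mem_range.mp hi⟩, j), rfl⟩
  calc _ ≤ Module.finrank K (Submodule.span K (Set.range fun kj : Fin (n * M) × Fin m =>
        L fun l => (A ^ (kj.1 : ℕ) * B) l kj.2)) := by
        have := FiniteDimensional.span_of_finite K (Set.finite_range
          fun kj : Fin (n * M) × Fin m => L fun l => (A ^ (kj.1 : ℕ) * B) l kj.2)
        exact Submodule.finrank_mono hle
    _ ≤ Fintype.card (Fin (n * M) × Fin m) := finrank_range_le_card _
    _ = n * M * m := by simp

/-- Let `J` be a matrix over a ring `R`, with possibly infinitely many columns, whose columns do not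
span at any point `t`. Then its rows satisfy a relation with coefficients in `R` that is nontrivial
at some point. The coefficients are the cofactors in the expansion of a bordered minor of maximal
size. -/
theorem exists_relation_of_finrank_span_lt {K R T ι κ : Type*} [Field K] [CommRing R] [Fintype ι]
    [Nonempty T] (ev : T → R →+* K) (J : ι → κ → R)
    (hJ : ∀ t, Module.finrank K
      (Submodule.span K (Set.range fun k i => ev t (J i k))) < Fintype.card ι) :
    ∃ (c : ι → R) (i₀ : ι) (t₀ : T), ev t₀ (c i₀) ≠ 0 ∧
      ∀ k t, ev t (∑ i, c i * J i k) = 0 := by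
  classical
  -- `P r`: some minor of size `r` does not vanish identically.
  let P : ℕ → Prop := fun r => ∃ (t : T) (f : Fin r → ι) (g : Fin r → κ),
    ev t (Matrix.det (Matrix.of fun a b => J (f a) (g b))) ≠ 0
  have hdet : ∀ (t : T) {r : ℕ} (f : Fin r → ι) (g : Fin r → κ),
      ev t (Matrix.det (Matrix.of fun a b => J (f a) (g b))) =
        Matrix.det (Matrix.of fun a b => ev t (J (f a) (g b))) := by
    intro t r f g
    exact RingHom.map_det _ _
  have hlt : ∀ r, P r → r < Fintype.card ι := by
    rintro r ⟨t, f, g, h⟩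
    rw [hdet] at h
    refine lt_of_le_of_lt ?_ (hJ t)
    have h1 : LinearIndependent K (fun b a => ev t (J (f a) (g b))) :=
      Matrix.linearIndependent_cols_of_det_ne_zero h
    have h2 : LinearIndependent K (fun b i => ev t (J i (g b))) :=
      LinearIndependent.of_comp (LinearMap.funLeft K K f) h1
    have h3 := linearIndependent_iff_card_eq_finrank_span.mp h2
    rw [Fintype.card_fin, Set.finrank] at h3
    rw [h3]
    refine Submodule.finrank_mono (Submodule.span_mono ?_)
    rintro _ ⟨b, rfl⟩
    exact ⟨g b, rfl⟩
  have hP0 : P 0 := by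
    obtain ⟨t⟩ := ‹Nonempty T›
    exact ⟨t, Fin.elim0, Fin.elim0, by simp⟩
  obtain ⟨r, hr, hr'⟩ : ∃ r, P r ∧ ¬ P (r + 1) := by
    by_contra! h
    have hall : ∀ r, P r := fun r => Nat.rec hP0 (fun r ih => h r ih) r
    exact lt_irrefl _ (hlt _ (hall (Fintype.card ι)))
  obtain ⟨t₀, f, g, hfg⟩ := hr
  -- A row outside the minor exists, because the size of a nonvanishing minor is at most the rank.
  obtain ⟨i₀, hi₀⟩ : ∃ i₀, ∀ a, f a ≠ i₀ := by
    by_contra! h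
    have := Fintype.card_le_of_surjective f h
    have h2 := hlt r ⟨t₀, f, g, hfg⟩
    rw [Fintype.card_fin] at this
    omega
  -- Bordering the minor by the row `i₀` and an arbitrary column `k` gives a minor that vanishes
  -- identically; its expansion along the column `k` is the relation, and the coefficient of the row
  -- `i₀` is the nonvanishing minor itself.
  let f' : Fin (r + 1) → ι := Fin.cons i₀ f
  let e : Fin (r + 1) → R := fun a =>
    (-1) ^ (a : ℕ) * Matrix.det (Matrix.of fun a' b => J (f' (a.succAbove a')) (g b))
  refine ⟨fun i => ∑ a, if f' a = i then e a else 0, i₀, t₀, ?_, ?_⟩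
  · have : (∑ a, if f' a = i₀ then e a else 0) =
        Matrix.det (Matrix.of fun a b => J (f a) (g b)) := by
      rw [Fin.sum_univ_succ]
      simp [f', hi₀, e]
    simpa only [this] using hfg
  · intro k t
    by_contra hne
    refine hr' ⟨t, f', Fin.cons k g, ?_⟩
    convert hne using 2
    rw [Matrix.det_succ_column_zero]
    simp only [Finset.sum_mul, ite_mul, zero_mul]
    rw [Finset.sum_comm]
    refine Finset.sum_congr rfl fun a _ => ?_
    rw [Finset.sum_ite_eq]
    have : (Matrix.of fun a b => J (f' a) ((Fin.cons k g : Fin (r + 1) → κ) b)).submatrix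
        a.succAbove Fin.succ = Matrix.of fun a' b => J (f' (a.succAbove a')) (g b) := by
      ext; simp
    rw [this]
    simp only [Finset.mem_univ, if_true, e, Fin.cons_zero, Matrix.of_apply]
    ring

/-- The columns of all `A ^ k * B` are solutions of one nontrivial linear differential equation in
the two derivations `D₁`, `D₂`, with coefficients in `R`; it holds at all points of `T`. -/
theorem exists_differential_relation {K R T : Type*} [Field K] [CommRing R] [Algebra K R]
    [Nonempty T] {n m : ℕ} (hn : 0 < n) (ev : T → R →ₐ[K] K) (D₁ D₂ : Derivation K R R)
    (A : Matrix (Fin n) (Fin n) R) (B : Matrix (Fin n) (Fin m) R) :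
    ∃ (N : ℕ) (c : (Fin (N + 1) × Fin (N + 1)) × Fin n → R)
      (i₀ : (Fin (N + 1) × Fin (N + 1)) × Fin n) (t₀ : T), ev t₀ (c i₀) ≠ 0 ∧
      ∀ (k : ℕ) (j : Fin m) (t : T),
        ev t (∑ i, c i * (⇑D₁)^[i.1.1] ((⇑D₂)^[i.1.2] ((A ^ k * B) i.2 j))) = 0 := by
  -- `(N + 1) ^ 2 > m * (2 * N + 1)` holds for this `N`, and for `a, b ≤ N` the value of
  -- `D₁ ^ a D₂ ^ b f` at a point is zero if `f` vanishes there to order `2 * N + 1`.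
  let N := 2 * m
  let ι := (Fin (N + 1) × Fin (N + 1)) × Fin n
  let M := 2 * N + 1
  obtain ⟨c, i₀, t₀, h0, h⟩ := exists_relation_of_finrank_span_lt (fun t => (ev t : R →+* K))
    (fun (i : ι) (kj : ℕ × Fin m) =>
      (⇑D₁)^[i.1.1] ((⇑D₂)^[i.1.2] ((A ^ kj.1 * B) i.2 kj.2))) (by
    intro t
    let L : (Fin n → R) →ₗ[K] (ι → K) := LinearMap.pi fun i =>
      (ev t).toLinearMap ∘ₗ ((D₁ : R →ₗ[K] R) ^ (i.1.1 : ℕ)) ∘ₗ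
        ((D₂ : R →ₗ[K] R) ^ (i.1.2 : ℕ)) ∘ₗ LinearMap.proj i.2
    have hLapp : ∀ v i, L v i = ev t ((⇑D₁)^[i.1.1] ((⇑D₂)^[i.1.2] (v i.2))) := by
      intro v i
      simp [L, Module.End.coe_pow]
    have hL : ∀ v : Fin n → R, (∀ l, v l ∈ RingHom.ker (ev t) ^ M) → L v = 0 := by
      intro v hv
      ext i
      rw [hLapp]
      have h1 : (⇑D₁)^[i.1.1] ((⇑D₂)^[i.1.2] (v i.2)) ∈ RingHom.ker (ev t) ^ 1 := by
        refine derivation_iterate_mem_pow D₁ _ _ _ (derivation_iterate_mem_pow D₂ _ _ _ ?_)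
        refine Ideal.pow_le_pow_right ?_ (hv i.2)
        have := i.1.1.isLt
        have := i.1.2.isLt
        omega
      simpa [RingHom.mem_ker] using h1
    have key := finrank_span_jets_le M (ev t) L hL A B
    have hset : (fun (kj : ℕ × Fin m) (i : ι) => (ev t : R →+* K)
        ((⇑D₁)^[i.1.1] ((⇑D₂)^[i.1.2] ((A ^ kj.1 * B) i.2 kj.2)))) =
        fun kj : ℕ × Fin m => L fun l => (A ^ kj.1 * B) l kj.2 := by
      funext kj i
      rw [hLapp]; rfl
    rw [hset]
    refine lt_of_le_of_lt key ?_
    have hcard : Fintype.card ι = (N + 1) * (N + 1) * n := by simp [ι]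
    rw [hcard, mul_assoc, mul_comm _ n]
    refine Nat.mul_lt_mul_of_pos_left ?_ hn
    simp only [M, N]
    nlinarith)
  exact ⟨N, c, i₀, t₀, h0, fun k j t => h (k, j) t⟩

/-! ### Smooth functions, directional derivatives and integration by parts -/

/-- The `𝕜`-algebra of functions `E → 𝕜` that are infinitely differentiable over `ℝ`. Working with
globally defined functions makes it a ring with derivations; functions given on a smaller set enter
after multiplication by a cutoff. -/
def smoothFunctions (𝕜 : Type*) [RCLike 𝕜] (E : Type*) [NormedAddCommGroup E] [NormedSpace ℝ E] :
    Subalgebra 𝕜 (E → 𝕜) where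
  carrier := {f | ContDiff ℝ (⊤ : ℕ∞) f}
  mul_mem' := fun {f g} (hf : ContDiff ℝ (⊤ : ℕ∞) f) (hg : ContDiff ℝ (⊤ : ℕ∞) g) => hf.mul hg
  add_mem' := fun {f g} (hf : ContDiff ℝ (⊤ : ℕ∞) f) (hg : ContDiff ℝ (⊤ : ℕ∞) g) => hf.add hg
  algebraMap_mem' := fun c => (contDiff_const : ContDiff ℝ (⊤ : ℕ∞) fun _ : E => c)

section
variable {𝕜 : Type*} [RCLike 𝕜] {E : Type*} [NormedAddCommGroup E] [NormedSpace ℝ E]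

theorem contDiff_coe (f : smoothFunctions 𝕜 E) : ContDiff ℝ (⊤ : ℕ∞) (f : E → 𝕜) := f.2

theorem continuous_coe (f : smoothFunctions 𝕜 E) : Continuous (f : E → 𝕜) :=
  (contDiff_coe f).continuous

theorem differentiable_coe (f : smoothFunctions 𝕜 E) : Differentiable ℝ (f : E → 𝕜) :=
  (contDiff_coe f).differentiable (by simp)

/-- Evaluation of smooth functions at the point `x`. -/
def evalAt (x : E) : smoothFunctions 𝕜 E →ₐ[𝕜] 𝕜 :=
  (Pi.evalAlgHom 𝕜 (fun _ : E => 𝕜) x).comp (smoothFunctions 𝕜 E).val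

@[simp] theorem evalAt_apply (x : E) (f : smoothFunctions 𝕜 E) : evalAt x f = (f : E → 𝕜) x := rfl

/-- The derivative in the (real) direction `v`, as a derivation of the algebra of smooth
functions. -/
noncomputable def directionalDerivation (𝕜 : Type*) [RCLike 𝕜] {E : Type*} [NormedAddCommGroup E]
    [NormedSpace ℝ E] (v : E) :
    Derivation 𝕜 (smoothFunctions 𝕜 E) (smoothFunctions 𝕜 E) :=
  Derivation.mk'
    { toFun := fun f => ⟨fun x => fderiv ℝ (f : E → 𝕜) x v,
        ((contDiff_coe f).fderiv_right (m := (⊤ : ℕ∞)) (by simp)).clm_apply contDiff_const⟩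
      map_add' := fun f g => by
        ext x
        change fderiv ℝ ((f : E → 𝕜) + (g : E → 𝕜)) x v = _
        rw [fderiv_add (differentiable_coe f x) (differentiable_coe g x)]
        rfl
      map_smul' := fun c f => by
        ext x
        change fderiv ℝ (c • (f : E → 𝕜)) x v = _
        rw [fderiv_const_smul (differentiable_coe f x)]
        rfl }
    (fun f g => by
      ext x
      change fderiv ℝ ((f : E → 𝕜) * (g : E → 𝕜)) x v = _
      rw [fderiv_mul (differentiable_coe f x) (differentiable_coe g x)]
      rfl)

theorem directionalDerivation_apply (v : E) (f : smoothFunctions 𝕜 E) (x : E) :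
    (directionalDerivation 𝕜 v f : E → 𝕜) x = fderiv ℝ (f : E → 𝕜) x v := rfl

theorem tsupport_iterate_directionalDerivation_subset (v : E) (a : ℕ) (f : smoothFunctions 𝕜 E) :
    tsupport ((⇑(directionalDerivation 𝕜 v))^[a] f : E → 𝕜) ⊆ tsupport (f : E → 𝕜) := by
  induction a with
  | zero => exact subset_rfl
  | succ a ih =>
    rw [Function.iterate_succ_apply']
    exact (tsupport_fderiv_apply_subset ℝ v).trans ih

variable [MeasurableSpace E] [BorelSpace E] (μ : Measure E)

theorem integrable_coe_mul [IsFiniteMeasureOnCompacts μ] {f : smoothFunctions 𝕜 E}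
    (hf : HasCompactSupport (f : E → 𝕜)) (g : smoothFunctions 𝕜 E) :
    Integrable (fun x => (f : E → 𝕜) x * (g : E → 𝕜) x) μ :=
  ((continuous_coe f).mul (continuous_coe g)).integrable_of_hasCompactSupport hf.mul_right

variable [FiniteDimensional ℝ E] [μ.IsAddHaarMeasure]

theorem integral_mul_directionalDerivation (v : E) {f : smoothFunctions 𝕜 E}
    (hf : HasCompactSupport (f : E → 𝕜)) (g : smoothFunctions 𝕜 E) :
    ∫ x, (f : E → 𝕜) x * (directionalDerivation 𝕜 v g : E → 𝕜) x ∂μ =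
      - ∫ x, (directionalDerivation 𝕜 v f : E → 𝕜) x * (g : E → 𝕜) x ∂μ := by
  have hf' : HasCompactSupport (directionalDerivation 𝕜 v f : E → 𝕜) :=
    hf.mono' ((subset_tsupport _).trans (tsupport_fderiv_apply_subset ℝ v))
  exact integral_mul_fderiv_eq_neg_fderiv_mul_of_integrable
    (integrable_coe_mul μ hf' g) (integrable_coe_mul μ hf (directionalDerivation 𝕜 v g))
    (integrable_coe_mul μ hf g)
    (fun x _ => differentiable_coe f x) (fun x _ => differentiable_coe g x)

theorem integral_mul_iterate_directionalDerivation (v : E) (a : ℕ) {f : smoothFunctions 𝕜 E}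
    (hf : HasCompactSupport (f : E → 𝕜)) (g : smoothFunctions 𝕜 E) :
    ∫ x, (f : E → 𝕜) x * ((⇑(directionalDerivation 𝕜 v))^[a] g : E → 𝕜) x ∂μ =
      (-1) ^ a * ∫ x, ((⇑(directionalDerivation 𝕜 v))^[a] f : E → 𝕜) x * (g : E → 𝕜) x ∂μ := by
  induction a generalizing g with
  | zero => simp
  | succ a ih =>
    rw [Function.iterate_succ_apply, ih, Function.iterate_succ_apply',
      integral_mul_directionalDerivation μ v _ g, pow_succ]
    · ring
    · exact hf.mono' ((subset_tsupport _).trans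
        (tsupport_iterate_directionalDerivation_subset v a f))

end

section
variable {K R : Type*} [CommRing K] [CommRing R] [Algebra K R]

theorem derivation_iterate_pow (D : Derivation K R R) {y : R} (hy : D y = 1) (b q : ℕ) :
    (⇑D)^[b] (y ^ q) = (q.descFactorial b : R) * y ^ (q - b) := by
  induction b with
  | zero => simp
  | succ b ih =>
    rw [Function.iterate_succ_apply', ih, Derivation.leibniz, Derivation.leibniz_pow, hy,
      Derivation.map_natCast, Nat.descFactorial_succ]
    simp only [smul_eq_mul, nsmul_eq_mul, mul_one, mul_zero, add_zero, Nat.cast_mul]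
    rw [Nat.sub_sub]
    ring

theorem derivation_iterate_mul_of_eq_zero (D : Derivation K R R) {x : R} (hx : D x = 0) (y : R)
    (b : ℕ) : (⇑D)^[b] (x * y) = x * (⇑D)^[b] y := by
  induction b with
  | zero => simp
  | succ b ih =>
    rw [Function.iterate_succ_apply', ih, Derivation.leibniz, hx, Function.iterate_succ_apply']
    simp

/-- At the common zero of two coordinates `x`, `y`, the derivatives of the monomials `x ^ p * y ^ q`
are, up to nonzero factors, dual to the monomials themselves. -/
theorem eval_iterate_derivation_monomial (ev : R →+* K) (D₁ D₂ : Derivation K R R) {x y : R}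
    (h₁x : D₁ x = 1) (h₁y : D₁ y = 0) (h₂x : D₂ x = 0) (h₂y : D₂ y = 1) (hx : ev x = 0)
    (hy : ev y = 0) (a b p q : ℕ) :
    ev ((⇑D₁)^[a] ((⇑D₂)^[b] (x ^ p * y ^ q))) =
      if a = p ∧ b = q then (p.factorial * q.factorial : K) else 0 := by
  have h1 : D₂ (x ^ p) = 0 := by rw [Derivation.leibniz_pow, h₂x]; simp
  have h2 : ∀ k l : ℕ, D₁ ((k : R) * y ^ l) = 0 := fun k l => by
    rw [Derivation.leibniz, Derivation.leibniz_pow, h₁y]; simp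
  have h4 : ∀ (z : R), ev z = 0 → ∀ s t : ℕ, (s.descFactorial t : K) * (ev z) ^ (s - t) =
      if t = s then (s.factorial : K) else 0 := by
    intro z hz s t
    split_ifs with h
    · subst h; simp [Nat.descFactorial_self]
    · rcases lt_or_gt_of_ne h with h | h
      · rw [hz, zero_pow (by omega), mul_zero]
      · rw [Nat.descFactorial_of_lt h]; simp
  rw [derivation_iterate_mul_of_eq_zero D₂ h1, derivation_iterate_pow D₂ h₂y, mul_comm,
    derivation_iterate_mul_of_eq_zero D₁ (h2 _ _), derivation_iterate_pow D₁ h₁x]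
  simp only [map_mul, map_natCast, map_pow]
  rw [h4 y hy, h4 x hx]
  by_cases ha : a = p <;> by_cases hb : b = q <;> simp [ha, hb, mul_comm]
end

/-! ### A smooth compactly supported annihilator of all columns -/

section
variable {𝕜 : Type*} [RCLike 𝕜] {E : Type*} [NormedAddCommGroup E] [NormedSpace ℝ E]

theorem coe_sum {ι : Type*} (s : Finset ι) (f : ι → smoothFunctions 𝕜 E) (x : E) :
    ((∑ i ∈ s, f i : smoothFunctions 𝕜 E) : E → 𝕜) x = ∑ i ∈ s, (f i : E → 𝕜) x :=
  map_sum (evalAt x) f s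

/-- The affine function `ℓ - ℓ x₀` as a smooth function. -/
theorem exists_centered_coordinate (ℓ : E →L[ℝ] ℝ) (x₀ : E) :
    ∃ f : smoothFunctions 𝕜 E, evalAt x₀ f = 0 ∧
      ∀ v, directionalDerivation 𝕜 v f = algebraMap 𝕜 _ ((ℓ v : ℝ) : 𝕜) := by
  have hd : ∀ x, HasFDerivAt (fun x => ((ℓ x - ℓ x₀ : ℝ) : 𝕜))
      ((RCLike.ofRealCLM (K := 𝕜)).comp ℓ) x := fun x =>
    (RCLike.ofRealCLM (K := 𝕜)).hasFDerivAt.comp x (ℓ.hasFDerivAt.sub_const _)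
  refine ⟨⟨fun x => ((ℓ x - ℓ x₀ : ℝ) : 𝕜), ?_⟩, by simp, fun v => ?_⟩
  · have h : ContDiff ℝ (⊤ : ℕ∞) fun x => ℓ x - ℓ x₀ := ℓ.contDiff.sub contDiff_const
    exact (RCLike.ofRealCLM (K := 𝕜)).contDiff.comp h
  · ext x
    rw [directionalDerivation_apply, (hd x).fderiv]
    rfl

variable [MeasurableSpace E] [BorelSpace E] (μ : Measure E) [FiniteDimensional ℝ E]
  [μ.IsAddHaarMeasure]

/-- The transpose of a linear differential operator with smooth coefficients `c`, applied to a
compactly supported function `ψ`. -/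
theorem integral_sum_adjoint {ι : Type*} [Fintype ι] {n : ℕ} (v₁ v₂ : E) (a b : ι → ℕ)
    (l : ι → Fin n) (c : ι → smoothFunctions 𝕜 E) {ψ : smoothFunctions 𝕜 E}
    (hψ : HasCompactSupport (ψ : E → 𝕜)) :
    ∃ Φ : Fin n → smoothFunctions 𝕜 E, (∀ l, tsupport (Φ l : E → 𝕜) ⊆ tsupport (ψ : E → 𝕜)) ∧
      ∀ G : Fin n → smoothFunctions 𝕜 E,
        ∫ x, ∑ l, (Φ l : E → 𝕜) x * (G l : E → 𝕜) x ∂μ =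
          ∫ x, (ψ : E → 𝕜) x * evalAt x (∑ i, c i * (⇑(directionalDerivation 𝕜 v₁))^[a i]
            ((⇑(directionalDerivation 𝕜 v₂))^[b i] (G (l i)))) ∂μ := by
  classical
  let θ : ι → smoothFunctions 𝕜 E := fun i =>
    (⇑(directionalDerivation 𝕜 v₂))^[b i] ((⇑(directionalDerivation 𝕜 v₁))^[a i] (ψ * c i))
  have hψc : ∀ i, HasCompactSupport ((ψ * c i : smoothFunctions 𝕜 E) : E → 𝕜) := fun i =>
    HasCompactSupport.mul_right (f := (ψ : E → 𝕜)) (f' := (c i : E → 𝕜)) hψ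
  have hθ₁ : ∀ i, HasCompactSupport
      ((⇑(directionalDerivation 𝕜 v₁))^[a i] (ψ * c i) : E → 𝕜) := fun i =>
    (hψc i).mono' ((subset_tsupport _).trans
      (tsupport_iterate_directionalDerivation_subset _ _ _))
  have hθs : ∀ i, tsupport (θ i : E → 𝕜) ⊆ tsupport (ψ : E → 𝕜) := fun i =>
    (tsupport_iterate_directionalDerivation_subset _ _ _).trans
      ((tsupport_iterate_directionalDerivation_subset _ _ _).trans
        (tsupport_mul_subset_left (f := (ψ : E → 𝕜)) (g := (c i : E → 𝕜))))
  have hθ : ∀ i, HasCompactSupport (θ i : E → 𝕜) := fun i =>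
    hψ.mono' ((subset_tsupport _).trans (hθs i))
  refine ⟨fun l₀ => ∑ i, if l i = l₀ then (-1) ^ (a i + b i) * θ i else 0, fun l₀ => ?_,
    fun G => ?_⟩
  · refine closure_minimal (fun x hx => ?_) (isClosed_tsupport _)
    by_contra hxψ
    refine hx ?_
    rw [coe_sum]
    refine Finset.sum_eq_zero fun i _ => ?_
    split_ifs with h
    · have : (θ i : E → 𝕜) x = 0 := image_eq_zero_of_notMem_tsupport fun h' => hxψ (hθs i h')
      change evalAt x ((-1) ^ (a i + b i) * θ i) = 0
      rw [map_mul, evalAt_apply x (θ i), this, mul_zero]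
    · rfl
  · have hL : ∀ x, ∑ l₀, ((∑ i, if l i = l₀ then (-1) ^ (a i + b i) * θ i else 0 :
          smoothFunctions 𝕜 E) : E → 𝕜) x * (G l₀ : E → 𝕜) x =
        ∑ i, (-1) ^ (a i + b i) * ((θ i : E → 𝕜) x * (G (l i) : E → 𝕜) x) := by
      intro x
      have h1 : (∑ l₀, (∑ i, if l i = l₀ then (-1) ^ (a i + b i) * θ i else 0) * G l₀ :
          smoothFunctions 𝕜 E) = ∑ i, (-1) ^ (a i + b i) * (θ i * G (l i)) := by
        simp only [Finset.sum_mul, ite_mul, zero_mul]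
        rw [Finset.sum_comm]
        simp [mul_assoc]
      have h2 := congrArg (evalAt x) h1
      rw [map_sum, map_sum] at h2
      simp only [map_mul, map_pow, map_neg, map_one] at h2
      exact h2
    have hR : ∀ x, (ψ : E → 𝕜) x * evalAt x (∑ i, c i * (⇑(directionalDerivation 𝕜 v₁))^[a i]
            ((⇑(directionalDerivation 𝕜 v₂))^[b i] (G (l i)))) =
        ∑ i, ((ψ * c i : smoothFunctions 𝕜 E) : E → 𝕜) x *
          ((⇑(directionalDerivation 𝕜 v₁))^[a i]
            ((⇑(directionalDerivation 𝕜 v₂))^[b i] (G (l i))) : E → 𝕜) x := by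
      intro x
      rw [map_sum, Finset.mul_sum]
      refine Finset.sum_congr rfl fun i _ => ?_
      rw [map_mul, ← mul_assoc]
      rfl
    simp_rw [hL, hR]
    rw [integral_finsetSum _ fun i _ => (integrable_coe_mul μ (hθ i) _).const_mul _,
      integral_finsetSum _ fun i _ => integrable_coe_mul μ (hψc i) _]
    refine Finset.sum_congr rfl fun i _ => ?_
    rw [integral_const_mul, integral_mul_iterate_directionalDerivation μ v₁ _ (hψc i),
      integral_mul_iterate_directionalDerivation μ v₂ _ (hθ₁ i), pow_add, mul_assoc]

/-- A nonzero compactly supported vector `Φ` that annihilates all columns of all `A ^ k * B`. It is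
the transpose of the differential relation between the columns, applied to a test function; it is
nonzero because it does not annihilate a suitable vector of monomials. -/
theorem exists_annihilator {n m : ℕ} (hn : 0 < n) {v₁ v₂ : E} {ℓ₁ ℓ₂ : E →L[ℝ] ℝ}
    (h₁₁ : ℓ₁ v₁ = 1) (h₁₂ : ℓ₁ v₂ = 0) (h₂₁ : ℓ₂ v₁ = 0) (h₂₂ : ℓ₂ v₂ = 1)
    {W : Set E} (hW : IsOpen W) (hWne : W.Nonempty)
    (A : Matrix (Fin n) (Fin n) (smoothFunctions 𝕜 E))
    (B : Matrix (Fin n) (Fin m) (smoothFunctions 𝕜 E)) :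
    ∃ Φ : Fin n → smoothFunctions 𝕜 E, (∀ l, HasCompactSupport (Φ l : E → 𝕜)) ∧
      (∀ l, tsupport (Φ l : E → 𝕜) ⊆ W) ∧
      (∀ (k : ℕ) (j : Fin m),
        ∫ x, ∑ l, (Φ l : E → 𝕜) x * ((A ^ k * B) l j : E → 𝕜) x ∂μ = 0) ∧
      ∃ g : Fin n → smoothFunctions 𝕜 E,
        ∫ x, ∑ l, (Φ l : E → 𝕜) x * (g l : E → 𝕜) x ∂μ ≠ 0 := by
  have : Nonempty W := hWne.to_subtype
  obtain ⟨N, c, i₀, t₀, hc, hrel⟩ := exists_differential_relation hn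
    (fun t : W => evalAt (𝕜 := 𝕜) (t : E)) (directionalDerivation 𝕜 v₁)
    (directionalDerivation 𝕜 v₂) A B
  obtain ⟨x, hx, hdx⟩ := exists_centered_coordinate (𝕜 := 𝕜) ℓ₁ (t₀ : E)
  obtain ⟨y, hy, hdy⟩ := exists_centered_coordinate (𝕜 := 𝕜) ℓ₂ (t₀ : E)
  let g : Fin n → smoothFunctions 𝕜 E := fun l =>
    if l = i₀.2 then x ^ (i₀.1.1 : ℕ) * y ^ (i₀.1.2 : ℕ) else 0
  let h : smoothFunctions 𝕜 E := ∑ i, c i * (⇑(directionalDerivation 𝕜 v₁))^[i.1.1]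
    ((⇑(directionalDerivation 𝕜 v₂))^[i.1.2] (g i.2))
  have hh : (h : E → 𝕜) t₀ ≠ 0 := by
    have hmono := fun a b => eval_iterate_derivation_monomial
      (evalAt (𝕜 := 𝕜) (t₀ : E) : smoothFunctions 𝕜 E →+* 𝕜)
      (directionalDerivation 𝕜 v₁) (directionalDerivation 𝕜 v₂) (x := x) (y := y)
      (by rw [hdx, h₁₁]; simp) (by rw [hdy, h₂₁]; simp) (by rw [hdx, h₁₂]; simp)
      (by rw [hdy, h₂₂]; simp) hx hy a b i₀.1.1 i₀.1.2
    have h1 : (h : E → 𝕜) t₀ = evalAt (t₀ : E) (c i₀) *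
        ((i₀.1.1 : ℕ).factorial * (i₀.1.2 : ℕ).factorial : 𝕜) := by
      change evalAt (t₀ : E) h = _
      rw [map_sum, Finset.sum_eq_single i₀]
      · rw [map_mul]
        congr 1
        simpa [g] using hmono i₀.1.1 i₀.1.2
      · intro i _ hi
        rw [map_mul]
        by_cases hl : i.2 = i₀.2
        · have hne : ¬ ((i.1.1 : ℕ) = i₀.1.1 ∧ (i.1.2 : ℕ) = i₀.1.2) := fun hab =>
            hi (Prod.ext (Prod.ext (Fin.ext hab.1) (Fin.ext hab.2)) hl)
          have h2 := hmono i.1.1 i.1.2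
          rw [if_neg hne] at h2
          have h3 : g i.2 = x ^ (i₀.1.1 : ℕ) * y ^ (i₀.1.2 : ℕ) := by simp [g, hl]
          rw [h3]
          exact mul_eq_zero_of_right _ h2
        · have h3 : g i.2 = 0 := by simp [g, hl]
          rw [h3, iterate_map_zero, iterate_map_zero, map_zero, mul_zero]
      · simp
    rw [h1]
    exact mul_ne_zero hc (mul_ne_zero (Nat.cast_ne_zero.mpr (Nat.factorial_ne_zero _))
      (Nat.cast_ne_zero.mpr (Nat.factorial_ne_zero _)))
  obtain ⟨ρ, hρW, hρc, hρs, hρ01, hρ1⟩ :=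
    exists_contDiff_tsupport_subset (n := ⊤) (hW.mem_nhds t₀.2)
  -- With this test function, `ψ * h = ρ * ‖h‖ ^ 2` is nonnegative and positive at `t₀`.
  let ψ : smoothFunctions 𝕜 E := ⟨fun x => (ρ x : 𝕜) * (starRingEnd 𝕜) ((h : E → 𝕜) x),
    ContDiff.mul ((RCLike.ofRealCLM (K := 𝕜)).contDiff.comp hρs)
      ((RCLike.conjCLE (K := 𝕜)).contDiff.comp (contDiff_coe h))⟩
  have hψs : tsupport (ψ : E → 𝕜) ⊆ tsupport ρ := by
    refine closure_mono fun x hx => ?_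
    intro h0
    refine hx ?_
    change (ρ x : 𝕜) * _ = 0
    rw [h0]; simp
  have hψc : HasCompactSupport (ψ : E → 𝕜) :=
    hρc.mono' ((subset_tsupport _).trans hψs)
  obtain ⟨Φ, hΦs, hΦ⟩ := integral_sum_adjoint μ v₁ v₂ (fun i => (i.1.1 : ℕ))
    (fun i => (i.1.2 : ℕ)) (fun i => i.2) c hψc
  refine ⟨Φ, fun l => hψc.mono' ((subset_tsupport _).trans (hΦs l)),
    fun l => (hΦs l).trans (hψs.trans hρW), fun k j => ?_, g, ?_⟩
  · rw [hΦ fun l => (A ^ k * B) l j]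
    refine integral_eq_zero_of_ae (Filter.Eventually.of_forall fun x => ?_)
    by_cases hx : x ∈ tsupport (ψ : E → 𝕜)
    · exact mul_eq_zero_of_right _ (hrel k j ⟨x, hρW (hψs hx)⟩)
    · exact mul_eq_zero_of_left (image_eq_zero_of_notMem_tsupport hx) _
  · rw [hΦ g]
    have hint : ∀ x, (ψ : E → 𝕜) x * evalAt x h = ((ρ x * ‖(h : E → 𝕜) x‖ ^ 2 : ℝ) : 𝕜) := by
      intro x
      change (ρ x : 𝕜) * (starRingEnd 𝕜) ((h : E → 𝕜) x) * (h : E → 𝕜) x = _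
      rw [mul_assoc, RCLike.conj_mul]
      push_cast
      rfl
    change ∫ x, (ψ : E → 𝕜) x * evalAt x h ∂μ ≠ 0
    simp_rw [hint]
    rw [integral_ofReal]
    have hpos : 0 < ∫ x, ρ x * ‖(h : E → 𝕜) x‖ ^ 2 ∂μ := by
      refine Continuous.integral_pos_of_hasCompactSupport_nonneg_nonzero (x := (t₀ : E))
        (hρs.continuous.mul ((continuous_coe h).norm.pow 2)) hρc.mul_right
        (fun x => mul_nonneg (hρ01 (Set.mem_range_self x)).1 (sq_nonneg _)) ?_
      rw [hρ1, one_mul]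
      exact pow_ne_zero _ (norm_ne_zero_iff.mpr hh)
    exact_mod_cast hpos.ne'

end

/-! ### The controllable subspace is a proper subspace -/

section
variable {𝕜 : Type*} [RCLike 𝕜] {d : ℕ} {S : Set (EuclideanSpace ℝ (Fin d))}

theorem IsRealAnalytic.continuous {f : S → ℝ} (hf : IsRealAnalytic f) : Continuous f := by
  obtain ⟨U, -, hSU, g, hg, hgf⟩ := hf
  have : f = S.domRestrict g := funext fun σ => (hgf σ).symm
  rw [this]
  exact (hg.continuousOn.mono hSU).domRestrict

theorem IsRealAnalyticMatrix.continuous {k l : ℕ} {F : S → Matrix (Fin k) (Fin l) 𝕜}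
    (hF : IsRealAnalyticMatrix F) : Continuous F := by
  refine continuous_matrix fun i j => ?_
  have h : (fun σ => F σ i j) =
      fun σ => ((RCLike.re (F σ i j) : ℝ) : 𝕜) + ((RCLike.im (F σ i j) : ℝ) : 𝕜) * RCLike.I :=
    funext fun σ => (RCLike.re_add_im _).symm
  rw [h]
  exact (RCLike.continuous_ofReal.comp (hF i j).1.continuous).add
    ((RCLike.continuous_ofReal.comp (hF i j).2.continuous).mul continuous_const)

theorem IsRealAnalytic.exists_contDiff_eq {f : S → ℝ} (hf : IsRealAnalytic f)
    {ρ : EuclideanSpace ℝ (Fin d) → ℝ} (hρ : ContDiff ℝ (⊤ : ℕ∞) ρ) (hρS : tsupport ρ ⊆ S) :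
    ∃ F : EuclideanSpace ℝ (Fin d) → ℝ, ContDiff ℝ (⊤ : ℕ∞) F ∧ ∀ σ : S, ρ σ = 1 → F σ = f σ := by
  obtain ⟨U, -, hSU, g, hg, hgf⟩ := hf
  refine ⟨fun x => ρ x * g x, ?_, fun σ hσ => by simp [hσ, hgf]⟩
  rw [contDiff_iff_contDiffAt]
  intro x
  by_cases hx : x ∈ tsupport ρ
  · exact hρ.contDiffAt.mul (hg x (hSU (hρS hx))).contDiffAt
  · have h0 : (fun x => ρ x * g x) =ᶠ[nhds x] fun _ => 0 := by
      filter_upwards [notMem_tsupport_iff_eventuallyEq.mp hx] with y hy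
      rw [hy, Pi.zero_apply, zero_mul]
    exact contDiffAt_const.congr_of_eventuallyEq h0

/-- Multiplication by a cutoff `ρ` supported in `S` turns a real-analytic matrix function on `S`
into a globally smooth one, unchanged where `ρ = 1`. -/
theorem IsRealAnalyticMatrix.exists_smoothFunctions_eq {k l : ℕ}
    {F : S → Matrix (Fin k) (Fin l) 𝕜} (hF : IsRealAnalyticMatrix F)
    {ρ : EuclideanSpace ℝ (Fin d) → ℝ} (hρ : ContDiff ℝ (⊤ : ℕ∞) ρ) (hρS : tsupport ρ ⊆ S) :
    ∃ G : Matrix (Fin k) (Fin l) (smoothFunctions 𝕜 (EuclideanSpace ℝ (Fin d))),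
      ∀ σ : S, ρ σ = 1 → G.map (evalAt (σ : EuclideanSpace ℝ (Fin d))) = F σ := by
  choose a ha ha' using fun i j => (hF i j).1.exists_contDiff_eq hρ hρS
  choose b hb hb' using fun i j => (hF i j).2.exists_contDiff_eq hρ hρS
  have hs : ∀ i j, ContDiff ℝ (⊤ : ℕ∞) fun x => (a i j x : 𝕜) + (b i j x : 𝕜) * RCLike.I :=
    fun i j => ContDiff.add ((RCLike.ofRealCLM (K := 𝕜)).contDiff.comp (ha i j))
      (ContDiff.mul ((RCLike.ofRealCLM (K := 𝕜)).contDiff.comp (hb i j)) contDiff_const)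
  refine ⟨fun i j => ⟨_, hs i j⟩, fun σ hσ => ?_⟩
  ext i j
  change (a i j σ : 𝕜) + (b i j σ : 𝕜) * RCLike.I = _
  rw [ha' i j σ hσ, hb' i j σ hσ, RCLike.re_add_im]

theorem continuous_column {n m : ℕ} {A : S → Matrix (Fin n) (Fin n) 𝕜}
    {B : S → Matrix (Fin n) (Fin m) 𝕜} (hA : Continuous A) (hB : Continuous B) (k : ℕ)
    (j : Fin m) : Continuous (column A B k j) :=
  (PiLp.continuous_toLp 2 _).comp
    (continuous_pi fun i => ((hA.pow k).matrix_mul hB).matrix_elem i j)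

theorem continuous_of_mem_span_column {n m : ℕ} {A : S → Matrix (Fin n) (Fin n) 𝕜}
    {B : S → Matrix (Fin n) (Fin m) 𝕜} (hA : Continuous A) (hB : Continuous B)
    {g : S → EuclideanSpace 𝕜 (Fin n)}
    (hg : g ∈ Submodule.span 𝕜 (Set.range fun kj : ℕ × Fin m => column A B kj.1 kj.2)) :
    Continuous g := by
  induction hg using Submodule.span_induction with
  | mem g hg => obtain ⟨⟨k, j⟩, rfl⟩ := hg; exact continuous_column hA hB k j
  | zero => exact continuous_const
  | add f g _ _ hf hg => exact hf.add hg
  | smul c f _ hf => exact hf.const_smul c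

theorem isFiniteMeasure_lebesgueOn (hS : IsCompact S) : IsFiniteMeasure (lebesgueOn S) := by
  refine ⟨?_⟩
  rw [lebesgueOn, comap_subtype_coe_apply hS.measurableSet, Set.image_univ, Subtype.range_coe]
  exact hS.measure_lt_top

theorem mem_profileSpace_of_continuous (hS : IsCompact S) {n : ℕ}
    {f : S → EuclideanSpace 𝕜 (Fin n)} (hf : Continuous f) (p : ℝ≥0∞) :
    f ∈ profileSpace 𝕜 S n p := by
  refine ⟨fun _ => ?_, fun _ => hf⟩
  have := isFiniteMeasure_lebesgueOn hS
  have := isCompact_iff_compactSpace.mp hS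
  obtain ⟨C, hC⟩ := isCompact_univ.exists_bound_of_continuousOn hf.continuousOn
  exact MemLp.of_bound hf.aestronglyMeasurable C
    (Filter.Eventually.of_forall fun σ => hC σ (Set.mem_univ σ))

theorem aestronglyMeasurable_of_mem_profileSpace {n : ℕ} {p : ℝ≥0∞}
    {f : S → EuclideanSpace 𝕜 (Fin n)} (hf : f ∈ profileSpace 𝕜 S n p) :
    AEStronglyMeasurable f (lebesgueOn S) := by
  by_cases hp : p = ∞
  · exact (hf.2 hp).aestronglyMeasurable
  · exact (hf.1 hp).1

/-- Pairing with continuous functions on the compact set `S` is bounded for the `L^p` seminorm. -/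
theorem enorm_integral_pairing_le (hS : IsCompact S) {n : ℕ}
    {Φ : Fin n → EuclideanSpace ℝ (Fin d) → 𝕜} (hΦ : ∀ l, Continuous (Φ l)) {p : ℝ≥0∞}
    (hp : 1 ≤ p) :
    ∃ D : ℝ, 0 ≤ D ∧ ∀ f : S → EuclideanSpace 𝕜 (Fin n), Continuous f →
      ‖∫ σ, ∑ l, Φ l σ * f σ l ∂(lebesgueOn S)‖ₑ ≤
        ENNReal.ofReal D * eLpNorm f p (lebesgueOn S) := by
  have := isFiniteMeasure_lebesgueOn hS
  choose C hC using fun l => hS.exists_bound_of_continuousOn (hΦ l).continuousOn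
  let K : ℝ≥0∞ := (lebesgueOn S) Set.univ ^ (1 / (1 : ℝ≥0∞).toReal - 1 / p.toReal)
  have hK : K ≠ ∞ := by
    refine ENNReal.rpow_ne_top_of_nonneg ?_ (measure_ne_top _ _)
    by_cases hpt : p = ∞
    · simp [hpt]
    · have h1 : (1 : ℝ) ≤ p.toReal := by
        simpa using ENNReal.toReal_mono hpt hp
      simpa using inv_le_one_of_one_le₀ h1
  let C' : ℝ := ∑ l, |C l|
  have hC' : 0 ≤ C' := Finset.sum_nonneg fun l _ => abs_nonneg _
  refine ⟨C' * K.toReal, by positivity, fun f hf => ?_⟩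
  have hpt : ∀ σ : S, ‖∑ l, Φ l σ * f σ l‖ₑ ≤ ENNReal.ofReal C' * ‖f σ‖ₑ := by
    intro σ
    have h1 : ‖∑ l, Φ l σ * f σ l‖ ≤ C' * ‖f σ‖ := by
      rw [Finset.sum_mul]
      refine norm_sum_le_of_le _ fun l _ => ?_
      rw [norm_mul]
      exact mul_le_mul ((hC l σ σ.2).trans (le_abs_self _)) (PiLp.norm_apply_le _ _)
        (norm_nonneg _) (abs_nonneg _)
    rw [← ofReal_norm, ← ofReal_norm, ← ENNReal.ofReal_mul hC']
    exact ENNReal.ofReal_le_ofReal h1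
  calc _ ≤ ∫⁻ σ, ‖∑ l, Φ l σ * f σ l‖ₑ ∂(lebesgueOn S) := enorm_integral_le_lintegral_enorm _
    _ ≤ ∫⁻ σ, ENNReal.ofReal C' * ‖f σ‖ₑ ∂(lebesgueOn S) := lintegral_mono hpt
    _ = ENNReal.ofReal C' * eLpNorm f 1 (lebesgueOn S) := by
        rw [lintegral_const_mul' _ _ ENNReal.ofReal_ne_top, eLpNorm_one_eq_lintegral_enorm]
    _ ≤ ENNReal.ofReal C' * (eLpNorm f p (lebesgueOn S) * K) := by
        gcongr
        exact eLpNorm_le_eLpNorm_mul_rpow_measure_univ hp hf.aestronglyMeasurable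
    _ = _ := by
        rw [ENNReal.ofReal_mul hC', ENNReal.ofReal_toReal hK]
        ring

/-- If `Φ` is supported in `W ⊆ S`, its pairing with a profile on `S` is an integral over the whole
space that sees the profile on `W` only. -/
theorem integral_pairing_eq (hS : IsCompact S) {n : ℕ} {W : Set (EuclideanSpace ℝ (Fin d))}
    (hWS : W ⊆ S) {Φ : Fin n → EuclideanSpace ℝ (Fin d) → 𝕜} (hΦ : ∀ l, tsupport (Φ l) ⊆ W)
    {f : S → EuclideanSpace 𝕜 (Fin n)} {G : Fin n → EuclideanSpace ℝ (Fin d) → 𝕜}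
    (hfG : ∀ σ : S, (σ : EuclideanSpace ℝ (Fin d)) ∈ W → ∀ l, f σ l = G l σ) :
    ∫ σ, ∑ l, Φ l σ * f σ l ∂(lebesgueOn S) = ∫ x, ∑ l, Φ l x * G l x := by
  have h0 : ∀ l x, x ∉ W → Φ l x = 0 := fun l x hx =>
    image_eq_zero_of_notMem_tsupport fun h => hx (hΦ l h)
  have h1 : ∀ σ : S, ∑ l, Φ l σ * f σ l = ∑ l, Φ l σ * G l σ := by
    intro σ
    refine Finset.sum_congr rfl fun l _ => ?_
    by_cases hσ : (σ : EuclideanSpace ℝ (Fin d)) ∈ W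
    · rw [hfG σ hσ]
    · rw [h0 l _ hσ, zero_mul, zero_mul]
  simp_rw [h1]
  rw [lebesgueOn, integral_subtype_comap hS.measurableSet (fun x => ∑ l, Φ l x * G l x)]
  refine setIntegral_eq_integral_of_forall_compl_eq_zero fun x hx => ?_
  exact Finset.sum_eq_zero fun l _ => by rw [h0 l x fun h => hx (hWS h), zero_mul]

/-- The controllable subspace is proper: the test profile `g₀`, the restriction of a smooth vector
that `Φ` does not annihilate, has positive `L^p` distance from the span of the columns. -/
theorem controllableSubspace_ne_profileSpace (hd : 2 ≤ d) (hS : IsCompact S)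
    (hU : ∃ U : Set (EuclideanSpace ℝ (Fin d)), IsOpen U ∧ U.Nonempty ∧ U ⊆ S)
    {n m : ℕ} (hn : 0 < n) {p : ℝ≥0∞} (hp : 1 ≤ p) {A : S → Matrix (Fin n) (Fin n) 𝕜}
    {B : S → Matrix (Fin n) (Fin m) 𝕜} (hA : IsRealAnalyticMatrix A)
    (hB : IsRealAnalyticMatrix B) :
    controllableSubspace p A B ≠ profileSpace 𝕜 S n p := by
  intro heq
  obtain ⟨U, hUo, ⟨s₀, hs₀⟩, hUS⟩ := hU
  obtain ⟨r, hr, hrU⟩ := Metric.isOpen_iff.mp hUo s₀ hs₀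
  let ρ : ContDiffBump s₀ := ⟨r / 4, r / 2, by positivity, by linarith⟩
  have hρS : tsupport ρ ⊆ S := by
    rw [ρ.tsupport_eq]
    exact (Metric.closedBall_subset_ball (by simp [ρ]; linarith)).trans (hrU.trans hUS)
  let W := Metric.ball s₀ ρ.rIn
  have hρW : ∀ x ∈ W, ρ x = 1 := fun x hx =>
    ρ.one_of_mem_closedBall (Metric.ball_subset_closedBall hx)
  have hWS : W ⊆ S := fun x hx => hρS <| subset_tsupport _ <| by
    rw [Function.mem_support, hρW x hx]; exact one_ne_zero
  obtain ⟨A', hA'⟩ := hA.exists_smoothFunctions_eq ρ.contDiff hρS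
  obtain ⟨B', hB'⟩ := hB.exists_smoothFunctions_eq ρ.contDiff hρS
  let i₁ : Fin d := ⟨0, by omega⟩
  let i₂ : Fin d := ⟨1, by omega⟩
  have hi : i₁ ≠ i₂ := by simp [i₁, i₂]
  obtain ⟨Φ, hΦc, hΦW, hΦ, g, hg⟩ := exists_annihilator
    (volume : Measure (EuclideanSpace ℝ (Fin d))) hn
    (v₁ := EuclideanSpace.single i₁ 1) (v₂ := EuclideanSpace.single i₂ 1)
    (ℓ₁ := EuclideanSpace.proj i₁) (ℓ₂ := EuclideanSpace.proj i₂)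
    (by simp) (by simp [hi]) (by simp [hi.symm]) (by simp) Metric.isOpen_ball
    (W := W) ⟨s₀, Metric.mem_ball_self ρ.rIn_pos⟩ A' B'
  set I : ℝ := ‖∫ x, ∑ l, (Φ l).1 x * (g l).1 x‖ with hI
  have hIpos : 0 < I := norm_pos_iff.mpr hg
  obtain ⟨D, hD, hbound⟩ := enorm_integral_pairing_le hS (fun l => continuous_coe (Φ l)) hp
  have hint : ∀ G : Fin n → smoothFunctions 𝕜 (EuclideanSpace ℝ (Fin d)),
      Integrable fun x => ∑ l, (Φ l).1 x * (G l).1 x :=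
    fun G => integrable_finsetSum _ fun l _ => integrable_coe_mul volume (hΦc l) (G l)
  -- Each element of the span agrees on `W` with a smooth vector that `Φ` annihilates.
  have hspan : ∀ f ∈ Submodule.span 𝕜 (Set.range fun kj : ℕ × Fin m => column A B kj.1 kj.2),
      ∃ G : Fin n → smoothFunctions 𝕜 (EuclideanSpace ℝ (Fin d)),
        (∀ σ : S, (σ : EuclideanSpace ℝ (Fin d)) ∈ W → ∀ l, f σ l = (G l).1 σ) ∧
        ∫ x, ∑ l, (Φ l).1 x * (G l).1 x = 0 := by
    intro f hf
    induction hf using Submodule.span_induction with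
    | mem f hf =>
      obtain ⟨⟨k, j⟩, rfl⟩ := hf
      refine ⟨fun l => (A' ^ k * B') l j, fun σ hσ l => ?_, hΦ k j⟩
      change (A σ ^ k * B σ) l j = evalAt (σ : EuclideanSpace ℝ (Fin d)) ((A' ^ k * B') l j)
      rw [← hA' σ (hρW _ hσ), ← hB' σ (hρW _ hσ), ← AlgHom.mapMatrix_apply, ← map_pow,
        AlgHom.mapMatrix_apply, ← Matrix.map_mul]
      rfl
    | zero => exact ⟨0, fun σ _ l => rfl, by simp⟩
    | add f₁ f₂ _ _ h₁ h₂ =>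
      obtain ⟨G₁, hG₁, hG₁'⟩ := h₁
      obtain ⟨G₂, hG₂, hG₂'⟩ := h₂
      refine ⟨G₁ + G₂, fun σ hσ l => ?_, ?_⟩
      · change f₁ σ l + f₂ σ l = _
        rw [hG₁ σ hσ, hG₂ σ hσ]; rfl
      · have h := integral_add (hint G₁) (hint G₂)
        rw [hG₁', hG₂', add_zero] at h
        rw [← h]
        refine integral_congr_ae (Filter.Eventually.of_forall fun x => ?_)
        simp [mul_add, Finset.sum_add_distrib]
    | smul c f _ h =>
      obtain ⟨G, hG, hG'⟩ := h
      refine ⟨c • G, fun σ hσ l => ?_, ?_⟩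
      · change c * f σ l = _
        rw [hG σ hσ]; rfl
      · have h := integral_const_mul (μ := volume) c
          fun x => ∑ l, (Φ l).1 x * (G l).1 x
        rw [hG', mul_zero] at h
        rw [← h]
        refine integral_congr_ae (Filter.Eventually.of_forall fun x => ?_)
        simp [Finset.mul_sum, mul_left_comm]
  let g₀ : S → EuclideanSpace 𝕜 (Fin n) := fun σ => WithLp.toLp 2 fun l => (g l).1 σ
  have hg₀ : Continuous g₀ := (PiLp.continuous_toLp 2 _).comp
    (continuous_pi fun l => (continuous_coe (g l)).comp continuous_subtype_val)
  have hmem : g₀ ∈ controllableSubspace p A B := by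
    rw [heq]; exact mem_profileSpace_of_continuous hS hg₀ p
  obtain ⟨f, hf, hfε⟩ := hmem.2 (I / (D + 1)) (by positivity)
  obtain ⟨G, hG, hG0⟩ := hspan f hf
  have h1 := hbound (fun σ => g₀ σ - f σ)
    (hg₀.sub (continuous_of_mem_span_column hA.continuous hB.continuous hf))
  rw [integral_pairing_eq hS hWS hΦW (G := fun l x => (g l).1 x - (G l).1 x)
    (fun σ hσ l => by change g₀ σ l - f σ l = _; rw [hG σ hσ])] at h1
  simp only [mul_sub, Finset.sum_sub_distrib] at h1
  rw [integral_sub (hint g) (hint G), hG0, sub_zero, ← ofReal_norm, ← hI] at h1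
  have h2 : ENNReal.ofReal I ≤ ENNReal.ofReal (D * (I / (D + 1))) := by
    rw [ENNReal.ofReal_mul hD]
    exact h1.trans (by gcongr)
  rw [ENNReal.ofReal_le_ofReal_iff (by positivity)] at h2
  have h3 : D * (I / (D + 1)) < I := by
    rw [mul_div_assoc', div_lt_iff₀ (by positivity)]
    nlinarith
  linarith

end

/-! ### Solutions starting at zero are uniform limits of spans of columns -/

section
variable {V : Type*} [NormedAddCommGroup V]

theorem norm_pow_apply_le {𝕜 : Type*} [NontriviallyNormedField 𝕜] [NormedSpace 𝕜 V]
    (L : V →L[𝕜] V) (k : ℕ) (x : V) : ‖(L ^ k) x‖ ≤ ‖L‖ ^ k * ‖x‖ := by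
  induction k with
  | zero => simp
  | succ k ih =>
    rw [pow_succ', pow_succ', mul_apply_eq_comp, mul_assoc]
    exact (L.le_opNorm _).trans (by gcongr)

theorem intervalIntegrable_clm_comp {𝕜 W : Type*} [NontriviallyNormedField 𝕜] [NormedSpace 𝕜 V]
    [NormedAddCommGroup W] [NormedSpace 𝕜 W] (L : W →L[𝕜] V) {f : ℝ → W} {a b : ℝ}
    (hf : IntervalIntegrable f volume a b) : IntervalIntegrable (fun s => L (f s)) volume a b :=
  ⟨L.integrable_comp hf.1, L.integrable_comp hf.2⟩

variable [NormedSpace ℝ V]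

/-- The `k`-fold iterated primitive of `f` based at `0`; for `k = 0` it is `f` itself. -/
noncomputable def iteratedPrimitive (f : ℝ → V) : ℕ → ℝ → V
  | 0 => f
  | k + 1 => fun t => ∫ s in (0 : ℝ)..t, iteratedPrimitive f k s

theorem continuousOn_iteratedPrimitive {f : ℝ → V} {T : ℝ} (hT : 0 ≤ T)
    (hf : ContinuousOn f (Set.Icc 0 T)) (k : ℕ) :
    ContinuousOn (iteratedPrimitive f k) (Set.Icc 0 T) := by
  induction k with
  | zero => exact hf
  | succ k ih =>
    have h := intervalIntegral.continuousOn_primitive_interval' (μ := volume) (a := 0)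
      (ih.intervalIntegrable_of_Icc hT) Set.left_mem_uIcc
    rwa [Set.uIcc_of_le hT] at h

theorem norm_iteratedPrimitive_le {f : ℝ → V} {T C : ℝ}
    (hC : ∀ t ∈ Set.Icc 0 T, ‖f t‖ ≤ C) (k : ℕ) :
    ∀ t ∈ Set.Icc 0 T, ‖iteratedPrimitive f k t‖ ≤ C * t ^ k / k.factorial := by
  induction k with
  | zero => simpa [iteratedPrimitive] using hC
  | succ k ih =>
    intro t ht
    have h1 : ‖∫ s in (0 : ℝ)..t, iteratedPrimitive f k s‖ ≤
        ∫ s in (0 : ℝ)..t, C * s ^ k / k.factorial := by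
      refine intervalIntegral.norm_integral_le_of_norm_le ht.1 ?_
        (Continuous.intervalIntegrable (by fun_prop) _ _)
      exact Filter.Eventually.of_forall fun s hs => ih s ⟨hs.1.le, hs.2.trans ht.2⟩
    refine h1.trans (le_of_eq ?_)
    rw [intervalIntegral.integral_div, intervalIntegral.integral_const_mul, integral_pow]
    rw [Nat.factorial_succ]
    push_cast
    have : (k.factorial : ℝ) ≠ 0 := by positivity
    field_simp
    simp

variable {𝕜 : Type*} [RCLike 𝕜] [NormedSpace 𝕜 V] [CompleteSpace V]
  {U : Type*} [NormedAddCommGroup U] [NormedSpace ℝ U] [NormedSpace 𝕜 U] [CompleteSpace U]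

/-- Picard iteration: the solution of `x' = L x + b u`, `x 0 = 0`, is the sum of the series of
`L ^ k b v_k`, with `v_k` the `(k + 1)`-fold primitive of `u`. The remainder after `K` terms is
`L ^ K` applied to the `K`-fold primitive of `x`. -/
theorem tendsto_sum_of_integral_equation (L : V →L[𝕜] V) (b : U →L[𝕜] V) {T : ℝ} (hT : 0 ≤ T)
    {u : ℝ → U} (hu : IntegrableOn u (Set.Icc 0 T)) {x : ℝ → V}
    (hx : ContinuousOn x (Set.Icc 0 T))
    (hxeq : ∀ t ∈ Set.Icc (0 : ℝ) T, x t = ∫ s in (0 : ℝ)..t, (L (x s) + b (u s))) :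
    Filter.Tendsto (fun K => ∑ k ∈ Finset.range K,
        (L ^ k) (b (iteratedPrimitive (fun t => ∫ s in (0 : ℝ)..t, u s) k T)))
      Filter.atTop (nhds (x T)) := by
  have hTT : T ∈ Set.Icc 0 T := Set.right_mem_Icc.mpr hT
  set v := iteratedPrimitive fun t => ∫ s in (0 : ℝ)..t, u s with hv
  have huT : IntervalIntegrable u volume 0 T := by
    rwa [intervalIntegrable_iff_integrableOn_Icc_of_le hT]
  have hut : ∀ t ∈ Set.Icc (0 : ℝ) T, IntervalIntegrable u volume 0 t := by
    intro t ht
    rw [intervalIntegrable_iff_integrableOn_Icc_of_le ht.1]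
    exact hu.mono_set (Set.Icc_subset_Icc_right ht.2)
  have hv0 : ContinuousOn (fun t => ∫ s in (0 : ℝ)..t, u s) (Set.Icc 0 T) := by
    have h := intervalIntegral.continuousOn_primitive_interval' (a := 0) huT Set.left_mem_uIcc
    rwa [Set.uIcc_of_le hT] at h
  have hvc : ∀ k, ContinuousOn (v k) (Set.Icc 0 T) := continuousOn_iteratedPrimitive hT hv0
  have hxc : ∀ k, ContinuousOn (iteratedPrimitive x k) (Set.Icc 0 T) :=
    continuousOn_iteratedPrimitive hT hx
  have hvi : ∀ k, ∀ t ∈ Set.Icc (0 : ℝ) T, IntervalIntegrable (v k) volume 0 t := fun k t ht =>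
    ((hvc k).mono (Set.Icc_subset_Icc_right ht.2)).intervalIntegrable_of_Icc ht.1
  have hxi : ∀ k, ∀ t ∈ Set.Icc (0 : ℝ) T,
      IntervalIntegrable (iteratedPrimitive x k) volume 0 t := fun k t ht =>
    ((hxc k).mono (Set.Icc_subset_Icc_right ht.2)).intervalIntegrable_of_Icc ht.1
  -- The `k`-fold primitive of the integral equation.
  have step : ∀ k, ∀ t ∈ Set.Icc (0 : ℝ) T,
      iteratedPrimitive x k t = L (iteratedPrimitive x (k + 1) t) + b (v k t) := by
    intro k
    induction k with
    | zero =>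
      intro t ht
      change x t = L (∫ s in (0 : ℝ)..t, x s) + b (∫ s in (0 : ℝ)..t, u s)
      have hx0 : IntervalIntegrable x volume 0 t := hxi 0 t ht
      rw [hxeq t ht, intervalIntegral.integral_add (intervalIntegrable_clm_comp L hx0)
          (intervalIntegrable_clm_comp b (hut t ht)),
        L.intervalIntegral_comp_comm hx0, b.intervalIntegral_comp_comm (hut t ht)]
    | succ k ih =>
      intro t ht
      change ∫ s in (0 : ℝ)..t, iteratedPrimitive x k s =
        L (∫ s in (0 : ℝ)..t, iteratedPrimitive x (k + 1) s) + b (∫ s in (0 : ℝ)..t, v k s)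
      rw [← L.intervalIntegral_comp_comm (hxi _ t ht),
        ← b.intervalIntegral_comp_comm (hvi k t ht),
        ← intervalIntegral.integral_add (intervalIntegrable_clm_comp L (hxi _ t ht))
          (intervalIntegrable_clm_comp b (hvi k t ht))]
      refine intervalIntegral.integral_congr fun s hs => ?_
      rw [Set.uIcc_of_le ht.1] at hs
      exact ih s ⟨hs.1, hs.2.trans ht.2⟩
  have hpart : ∀ K, ∑ k ∈ Finset.range K, (L ^ k) (b (v k T)) =
      x T - (L ^ K) (iteratedPrimitive x K T) := by
    intro K
    induction K with
    | zero => simp [iteratedPrimitive]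
    | succ K ih =>
      rw [Finset.sum_range_succ, ih, step K T hTT, map_add, pow_succ, mul_apply_eq_comp]
      abel
  obtain ⟨C, hC⟩ := isCompact_Icc.exists_bound_of_continuousOn hx
  have hrem : Filter.Tendsto (fun K => (L ^ K) (iteratedPrimitive x K T)) Filter.atTop
      (nhds 0) := by
    have h0 : Filter.Tendsto (fun K : ℕ => C * ((‖L‖ * T) ^ K / K.factorial)) Filter.atTop
        (nhds 0) := by
      simpa using (FloorSemiring.tendsto_pow_div_factorial_atTop (‖L‖ * T)).const_mul C
    refine squeeze_zero_norm (fun K => ?_) h0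
    calc ‖(L ^ K) (iteratedPrimitive x K T)‖
        ≤ ‖L‖ ^ K * ‖iteratedPrimitive x K T‖ := norm_pow_apply_le L K _
      _ ≤ ‖L‖ ^ K * (C * T ^ K / K.factorial) := by
          gcongr
          exact norm_iteratedPrimitive_le hC K T hTT
      _ = C * ((‖L‖ * T) ^ K / K.factorial) := by rw [mul_pow]; ring
  simp_rw [hpart]
  simpa using hrem.const_sub (x T)

end

section
variable {𝕜 : Type*} [RCLike 𝕜] {d : ℕ} {S : Set (EuclideanSpace ℝ (Fin d))} {n m : ℕ}

/-- The linear map sending a matrix to the continuous linear map between Euclidean spaces that it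
represents. -/
noncomputable def matrixCLM (k l : ℕ) :
    Matrix (Fin k) (Fin l) 𝕜 →ₗ[𝕜] EuclideanSpace 𝕜 (Fin l) →L[𝕜] EuclideanSpace 𝕜 (Fin k) :=
  LinearMap.toContinuousLinearMap.toLinearMap ∘ₗ Matrix.toEuclideanLin.toLinearMap

theorem matrixCLM_apply {k l : ℕ} (M : Matrix (Fin k) (Fin l) 𝕜) (v : EuclideanSpace 𝕜 (Fin l)) :
    matrixCLM k l M v = Matrix.toEuclideanLin M v := rfl

theorem exists_norm_matrixCLM_le (hS : IsCompact S) {k l : ℕ} {M : S → Matrix (Fin k) (Fin l) 𝕜}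
    (hM : Continuous M) : ∃ C, ∀ σ, ‖matrixCLM k l (M σ)‖ ≤ C := by
  have := isCompact_iff_compactSpace.mp hS
  have hc : Continuous fun σ => matrixCLM k l (M σ) :=
    (matrixCLM (𝕜 := 𝕜) k l).continuous_of_finiteDimensional.comp hM
  obtain ⟨C, hC⟩ := isCompact_univ.exists_bound_of_continuousOn hc.continuousOn
  exact ⟨C, fun σ => hC σ (Set.mem_univ σ)⟩

theorem matrixCLM_pow_apply (A : S → Matrix (Fin n) (Fin n) 𝕜)
    (B : S → Matrix (Fin n) (Fin m) 𝕜) (k : ℕ) (w : EuclideanSpace 𝕜 (Fin m)) (σ : S) :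
    (matrixCLM n n (A σ) ^ k) (matrixCLM n m (B σ) w) = ∑ j, w j • column A B k j σ := by
  have h1 : (matrixCLM n n (A σ) ^ k) (matrixCLM n m (B σ) w) =
      Matrix.toEuclideanLin (A σ ^ k * B σ) w := by
    induction k with
    | zero => simp [matrixCLM_apply]
    | succ k ih =>
      rw [pow_succ', mul_apply_eq_comp, ih, matrixCLM_apply, pow_succ',
        Matrix.mul_assoc]
      simp [Matrix.toLpLin_apply]
  rw [h1]
  ext i
  have h2 : (∑ j, w j • column A B k j σ) i = ∑ j, w j * (A σ ^ k * B σ) i j := by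
    simp [column]
  rw [h2]
  change ∑ j, (A σ ^ k * B σ) i j * w j = _
  exact Finset.sum_congr rfl fun j _ => mul_comm _ _

/-- A solution with zero initial profile is at time `T` a uniform limit of profiles in the span of
the columns. No measurability of the solution in `σ` is assumed; it follows from the series. -/
theorem IsSolution.exists_span_approx (hS : IsCompact S) {A : S → Matrix (Fin n) (Fin n) 𝕜}
    {B : S → Matrix (Fin n) (Fin m) 𝕜} (hA : Continuous A) (hB : Continuous B) {T : ℝ}
    (hT : 0 ≤ T) {u : ℝ → EuclideanSpace 𝕜 (Fin m)} (hu : IntegrableOn u (Set.Icc 0 T))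
    {x : ℝ → S → EuclideanSpace 𝕜 (Fin n)} (hx : IsSolution A B T u 0 x) :
    ∃ g : ℕ → S → EuclideanSpace 𝕜 (Fin n),
      (∀ K, g K ∈ Submodule.span 𝕜 (Set.range fun kj : ℕ × Fin m => column A B kj.1 kj.2)) ∧
      TendstoUniformly g (x T) Filter.atTop := by
  let v := iteratedPrimitive fun t => ∫ s in (0 : ℝ)..t, u s
  let f : ℕ → S → EuclideanSpace 𝕜 (Fin n) := fun k => ∑ j, v k T j • column A B k j
  have hf : ∀ k σ, f k σ = (matrixCLM n n (A σ) ^ k) (matrixCLM n m (B σ) (v k T)) := by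
    intro k σ
    rw [matrixCLM_pow_apply]
    simp [f]
  obtain ⟨a, ha⟩ := exists_norm_matrixCLM_le hS hA
  obtain ⟨β, hβ⟩ := exists_norm_matrixCLM_le hS hB
  have hTT : T ∈ Set.Icc 0 T := Set.right_mem_Icc.mpr hT
  have hC : ∀ t ∈ Set.Icc 0 T, ‖∫ s in (0 : ℝ)..t, u s‖ ≤ ∫ s in Set.Icc 0 T, ‖u s‖ := by
    intro t ht
    refine (intervalIntegral.norm_integral_le_integral_norm ht.1).trans ?_
    rw [intervalIntegral.integral_of_le ht.1]
    refine setIntegral_mono_set hu.norm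
      (Filter.Eventually.of_forall fun s => norm_nonneg _) ?_
    exact (Set.Ioc_subset_Icc_self.trans (Set.Icc_subset_Icc_right ht.2)).eventuallyLE
  set C := ∫ s in Set.Icc 0 T, ‖u s‖
  have hbound : ∀ k σ, ‖f k σ‖ ≤ β * C * ((a * T) ^ k / k.factorial) := by
    intro k σ
    have ha0 : 0 ≤ a := (norm_nonneg _).trans (ha σ)
    have hβ0 : 0 ≤ β := (norm_nonneg _).trans (hβ σ)
    rw [hf]
    calc _ ≤ ‖matrixCLM n n (A σ)‖ ^ k * ‖matrixCLM n m (B σ) (v k T)‖ :=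
          norm_pow_apply_le _ k _
      _ ≤ a ^ k * (β * (C * T ^ k / k.factorial)) := by
          gcongr
          · exact ha σ
          · exact (ContinuousLinearMap.le_opNorm _ _).trans (mul_le_mul (hβ σ)
              (norm_iteratedPrimitive_le hC k T hTT) (norm_nonneg _) hβ0)
      _ = _ := by rw [mul_pow]; ring
  have hsum : Summable fun k : ℕ => β * C * ((a * T) ^ k / k.factorial) :=
    (Real.summable_pow_div_factorial (a * T)).mul_left _
  have hunif := tendstoUniformly_tsum_nat hsum hbound
  refine ⟨fun K σ => ∑ k ∈ Finset.range K, f k σ, fun K => ?_, ?_⟩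
  · have : (fun σ => ∑ k ∈ Finset.range K, f k σ) = ∑ k ∈ Finset.range K, f k := by
      ext; simp
    change (fun σ => ∑ k ∈ Finset.range K, f k σ) ∈ _
    rw [this]
    refine Submodule.sum_mem _ fun k _ => Submodule.sum_mem _ fun j _ =>
      Submodule.smul_mem _ _ (Submodule.subset_span ⟨(k, j), rfl⟩)
  · have hlim : x T = fun σ => ∑' k, f k σ := by
      funext σ
      refine tendsto_nhds_unique ?_ (hunif.tendsto_at σ)
      have h := tendsto_sum_of_integral_equation (matrixCLM n n (A σ)) (matrixCLM n m (B σ)) hT hu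
        (hx σ).1 fun t ht => by rw [(hx σ).2 t ht, Pi.zero_apply, zero_add]; rfl
      refine h.congr fun K => Finset.sum_congr rfl fun k _ => (hf k σ).symm
    rw [hlim]
    exact hunif

/-- Controllability from the zero profile already forces the controllable subspace to be the whole
profile space. -/
theorem LpControllable.controllableSubspace_eq (hS : IsCompact S)
    {A : S → Matrix (Fin n) (Fin n) 𝕜} {B : S → Matrix (Fin n) (Fin m) 𝕜} (hA : Continuous A)
    (hB : Continuous B) {p : ℝ≥0∞} (hp : 1 ≤ p) (h : LpControllable p A B) :
    controllableSubspace p A B = profileSpace 𝕜 S n p := by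
  have := isFiniteMeasure_lebesgueOn hS
  refine Set.Subset.antisymm (fun f hf => hf.1) fun f hf => ⟨hf, fun ε hε => ?_⟩
  obtain ⟨T, hT, u, hu, x, hx, hxf⟩ := h 0 (mem_profileSpace_of_continuous hS continuous_const p)
    f hf (ε / 2) (by positivity)
  obtain ⟨g, hg, hgx⟩ := hx.exists_span_approx hS hA hB hT.le hu
  have hgc : ∀ K, Continuous (g K) := fun K => continuous_of_mem_span_column hA hB (hg K)
  have hxc : Continuous (x T) := hgx.continuous (Filter.Frequently.of_forall hgc)
  let D : ℝ := ((lebesgueOn S) Set.univ ^ p.toReal⁻¹).toReal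
  have hD : (lebesgueOn S) Set.univ ^ p.toReal⁻¹ = ENNReal.ofReal D := by
    rw [ENNReal.ofReal_toReal]
    exact ENNReal.rpow_ne_top_of_nonneg (by positivity) (measure_ne_top _ _)
  have hD0 : 0 ≤ D := ENNReal.toReal_nonneg
  obtain ⟨K, hK⟩ := (Metric.tendstoUniformly_iff.mp hgx (ε / 2 / (D + 1)) (by positivity)).exists
  refine ⟨g K, hg K, ?_⟩
  have h1 : eLpNorm (fun σ => x T σ - g K σ) p (lebesgueOn S) ≤ ENNReal.ofReal (ε / 2) := by
    refine (eLpNorm_le_of_ae_bound (C := ε / 2 / (D + 1))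
      (Filter.Eventually.of_forall fun σ => ?_)).trans ?_
    · rw [← dist_eq_norm]; exact (hK σ).le
    · rw [hD, ← ENNReal.ofReal_mul hD0]
      refine ENNReal.ofReal_le_ofReal ?_
      rw [mul_div_assoc', div_le_iff₀ (by positivity)]
      nlinarith
  have h2 : (fun σ => f σ - g K σ) =
      (fun σ => x T σ - g K σ) - fun σ => x T σ - f σ := by
    ext σ; simp
  calc eLpNorm (fun σ => f σ - g K σ) p (lebesgueOn S)
      ≤ eLpNorm (fun σ => x T σ - g K σ) p (lebesgueOn S) +
        eLpNorm (fun σ => x T σ - f σ) p (lebesgueOn S) := by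
        rw [h2]
        exact eLpNorm_sub_le (hxc.sub (hgc K)).aestronglyMeasurable
          (hxc.aestronglyMeasurable.sub (aestronglyMeasurable_of_mem_profileSpace hf)) hp
    _ < ENNReal.ofReal (ε / 2) + ENNReal.ofReal (ε / 2) :=
        ENNReal.add_lt_add_of_le_of_lt (h1.trans_lt ENNReal.ofReal_lt_top).ne h1 hxf
    _ = ENNReal.ofReal ε := by
        rw [← ENNReal.ofReal_add (by positivity) (by positivity), add_halves]

end

end LinearEnsemble

theorem theorem1 {𝕜 : Type*} [RCLike 𝕜] {d : ℕ} (hd : 2 ≤ d)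
    {S : Set (EuclideanSpace ℝ (Fin d))} (hS : IsCompact S)
    (hU : ∃ U : Set (EuclideanSpace ℝ (Fin d)), IsOpen U ∧ U.Nonempty ∧ U ⊆ S)
    {n m : ℕ} (hn : 0 < n) (hm : 0 < m) (p : ℝ≥0∞) (hp : 2 ≤ p) :
    (¬ ∃ (A : S → Matrix (Fin n) (Fin n) 𝕜) (B : S → Matrix (Fin n) (Fin m) 𝕜),
      LinearEnsemble.IsRealAnalyticMatrix A ∧ LinearEnsemble.IsRealAnalyticMatrix B ∧
        LinearEnsemble.LpControllable p A B) ∧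
    (∀ (A : S → Matrix (Fin n) (Fin n) 𝕜) (B : S → Matrix (Fin n) (Fin m) 𝕜),
      LinearEnsemble.IsRealAnalyticMatrix A → LinearEnsemble.IsRealAnalyticMatrix B →
        LinearEnsemble.controllableSubspace p A B ≠ LinearEnsemble.profileSpace 𝕜 S n p) := by
  have hp1 : 1 ≤ p := one_le_two.trans hp
  refine ⟨?_, fun A B hA hB =>
    LinearEnsemble.controllableSubspace_ne_profileSpace hd hS hU hn hp1 hA hB⟩
  rintro ⟨A, B, hA, hB, h⟩
  exact LinearEnsemble.controllableSubspace_ne_profileSpace hd hS hU hn hp1 hA hB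
    (h.controllableSubspace_eq hS hA.continuous hB.continuous hp1)
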